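/- Let $m\ge 6$ be an integer with $m\equiv 2\pmod 4$, let $n=3^m-1$, and let $\alpha$ be a primitive element of $\mathbb F_{3^m}$. For an integer $s$ let $C_s=\{s3^j \bmod n: j\ge 0\}\subseteq\mathbb Z/n\mathbb Z$ be the $3$-cyclotomic coset of $s$ modulo $n$. Put $$\delta_1=\frac{3^m-1}{2},\qquad \delta_2=\frac{3^m-1}{4},\qquad \delta_3=\frac{3^{m-6}-1}{5}+3^{m-6}+2\cdot 3^{m-5}+2\cdot 3^{m-3}+3^{m-2},$$ $$Z=\Big(\bigcup_{|s|<\delta_3}C_s\Big)\cup C_{\delta_1}\cup C_{\delta_2},\qquad g(x)=\prod_{i\in Z}(x-\alpha^i).$$ Then $g(x)\in\mathbb F_3[x]$ and $g(x)\mid x^n-1$. Let $\mathcal C=\langle g(x)\rangle\subseteq \mathbb F_3[x]/(x^n-1)$ be the ternary cyclic code of length $n$ generated by $g$, a word $(c_0,\dots,c_{n-1})$ being identified with $\sum_i c_ix^i$. Then: 1. $\mathcal C$ is a BCH code with designed distance $2\delta_3$, in the following sense: its defining set $Z$ contains the set $C_{b+1}\cup\dots\cup C_{b+\delta-1}$ for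 $b=-\delta_3$ and $\delta=2\delta_3$, and $2\delta_3$ is the largest $\delta$ for which $Z$ contains such a set for some integer $b$. 2. $\mathcal C$ is LCD, that is, $\mathcal C\cap\mathcal C^{\perp}=\{0\}$ for the Euclidean dual $\mathcal C^\perp$. 3. With $\operatorname{Tr}$ the trace from $\mathbb F_{3^m}$ to $\mathbb F_3$, $$\mathcal C=\big\{(\operatorname{Tr}(ax^2+bx^{-2}))_{x\in\mathbb F_{3^m}^*}: a,b\in\mathbb F_{3^m}\big\},$$ where the coordinates $0,\dots,n-1$ correspond to the elements $x=\theta^0,\theta^1,\dots,\theta^{n-1}$ of $\mathbb F_{3^m}^*$ for some primitive element $\theta$ of $\mathbb F_{3^m}$ with $\theta^2=\alpha^{\delta_3}$. 4. $\mathcal C$ has parameters $[3^m-1,\,2m,\,\ge 2\delta_3]$: its length is $3^m-1$, its dimension over $\mathbb F_3$ is $2m$, and its minimum Hamming distance is at least $2\delta_3$. -/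

import Mathlib

open Polynomial

/-- The `q`-cyclotomic coset `C_s = {s, sq, sq², …}` of `s` modulo `n`. -/
def cyclotomicCoset (q n : ℕ) (s : ZMod n) : Set (ZMod n) :=
  {i | ∃ j : ℕ, i = s * (q : ZMod n) ^ j}

/-- The defining set `C_{b+1} ∪ C_{b+2} ∪ ⋯ ∪ C_{b+δ-1}` of a BCH code of length `n` over a field
with `q` elements, with designed distance `δ` and offset `b`. -/
def bchDefiningSet (q n δ : ℕ) (b : ℤ) : Set (ZMod n) :=
  {i | ∃ k : ℕ, 1 ≤ k ∧ k < δ ∧ i ∈ cyclotomicCoset q n (((b + (k : ℤ) : ℤ) : ZMod n))}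

/-- The polynomial `∏_{i ∈ Z} (x - α ^ i)` over `F`; the residues modulo `n` are represented by
`0, 1, …, n - 1`. -/
noncomputable def zeroPolynomial {F : Type*} [Field F] (n : ℕ) (α : F) (Z : Set (ZMod n)) : F[X] :=
  open Classical in
  ∏ i ∈ (Finset.range n).filter (fun i : ℕ => (i : ZMod n) ∈ Z), (X - C (α ^ i))

/-- The identification of a word `(c_0, …, c_{n-1})` with `∑ c_i x ^ i`. -/
noncomputable def wordPolynomial (K : Type*) [Field K] (n : ℕ) : (Fin n → K) →ₗ[K] K[X] :=
  ∑ i : Fin n, (Polynomial.monomial (i : ℕ)).comp (LinearMap.proj i)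

/-- The cyclic code `⟨g⟩` of length `n`: the words whose polynomial lies, modulo `x ^ n - 1`, in the
ideal of `K[x] / (x ^ n - 1)` generated by `g`. -/
noncomputable def cyclicCode {K : Type*} [Field K] (n : ℕ) (g : K[X]) : Submodule K (Fin n → K) :=
  ((Ideal.span {AdjoinRoot.mk (X ^ n - 1 : K[X]) g}).restrictScalars K).comap
    ((AdjoinRoot.mkₐ (X ^ n - 1 : K[X])).toLinearMap.comp (wordPolynomial K n))

/-- The Euclidean dual code. -/
def dualCode {K : Type*} [Field K] {n : ℕ} (D : Submodule K (Fin n → K)) :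
    Submodule K (Fin n → K) where
  carrier := {a | ∀ c ∈ D, ∑ i, a i * c i = 0}
  zero_mem' := by
    intro c _
    simp
  add_mem' := by
    intro a b ha hb c hc
    simp [add_mul, Finset.sum_add_distrib, ha c hc, hb c hc]
  smul_mem' := by
    intro r a ha c hc
    simp [mul_assoc, ← Finset.mul_sum, ha c hc]

/-- A linear code with complementary dual. -/
def IsLCD {K : Type*} [Field K] {n : ℕ} (D : Submodule K (Fin n → K)) : Prop :=
  D ⊓ dualCode D = ⊥

/-- The code, of length `n`, has parameters `[n, k, ≥ d]`: its dimension is `k`, and distinct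
codewords have Hamming distance at least `d`. -/
def HasParametersGE {K : Type*} [Field K] [DecidableEq K] {n : ℕ} (D : Submodule K (Fin n → K))
    (k d : ℕ) : Prop :=
  Module.finrank K D = k ∧ ∀ x ∈ D, ∀ y ∈ D, x ≠ y → d ≤ hammingDist x y

/-! Write `m = 4l + 6`, `q = 3 ^ (4l)`, `d = δ₃`; then `5d = n - 18q`, so `d` lies just below `n/5`.
Everything reduces to one fact (`notMem_symmetricDefiningSet_iff`): the complement of `Z` is exactly
the union of the cosets of `d` and `-d`.

For this, follow the distance from `s * 3 ^ j` to `0` modulo `n`; it evolves under a folded tripling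
map of `[0, n/2]`, with fixed points `n/4` and `n/2` and the 2-cycle `n/5`, `2n/5`. An orbit that
stays in `[d, n/2]` and avoids `d` and both fixed points cannot go below `n/5`: it would have to
alternate around `n/5` with period 4, while its length `m` is 2 modulo 4. Above `n/5` the map is
expanding and affine along the orbit, so periodicity forces a fixed point. Conversely, five times an
element of the coset of `d` is `-2 * 3 ^ k`, and arithmetic modulo 5 shows that `d` has least
absolute value there.

Hence the nonzeros of the code are the conjugates of `β = α ^ d` and `β⁻¹`, which form two disjoint
orbits of size `m`. A discrete Fourier transform identifies the code with the words `Tr(a β ^ i + b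
β⁻¹ ^ i)`, giving the dimension. Nondegeneracy of the trace form gives LCD, and the zeros at
exponents of absolute value below `d` give the distance through the BCH bound. -/

/-! ### The folded tripling map -/

/-- Since `3y` lies in `[0, 3n/2]`, its nearest multiple of `n` is `0` or `n`; the three cases fold
this interval back onto `[0, n/2]`. -/
theorem ZMod.abs_valMinAbs_three_mul {n : ℕ} [NeZero n] (a : ZMod n) {y z : ℤ}
    (hy : y = |a.valMinAbs|) (hz : z = |(3 * a).valMinAbs|) :
    (6 * y ≤ n ∧ z = 3 * y) ∨ (n ≤ 6 * y ∧ 3 * y ≤ n ∧ z = n - 3 * y) ∨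
      (n ≤ 3 * y ∧ z = 3 * y - n) := by
  obtain ⟨hv1, hv2⟩ := a.valMinAbs_mem_Ioc
  obtain ⟨hw1, hw2⟩ := (3 * a).valMinAbs_mem_Ioc
  have hn : (0 : ℤ) < n := by exact_mod_cast Nat.pos_of_ne_zero (NeZero.ne n)
  have hc : (((3 * a).valMinAbs : ℤ) : ZMod n) = ((3 * a.valMinAbs : ℤ) : ZMod n) := by
    simp
  rw [ZMod.intCast_eq_intCast_iff_dvd_sub] at hc
  obtain ⟨t, ht⟩ := hc
  generalize (3 * a).valMinAbs = w at *
  generalize a.valMinAbs = v at *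
  generalize (n : ℤ) = N at *
  have h1 : t ≤ 2 := by
    by_contra! h
    nlinarith
  have h2 : -2 ≤ t := by
    by_contra! h
    nlinarith
  subst hy hz
  rcases abs_cases v with ⟨e1, _⟩ | ⟨e1, _⟩ <;> rcases abs_cases w with ⟨e2, _⟩ | ⟨e2, _⟩ <;>
    rw [e1, e2] <;> interval_cases t <;> omega

/-- A periodic orbit of the folded tripling map on `[0, n / 2]` that stays in `[d, n / 2]` either
meets `d` or is one of the fixed points `n / 4` and `n / 2`. -/
theorem exists_eq_of_forall_le_folded_tripling {q n d : ℤ} {l : ℕ} (y : ℕ → ℤ) (hq : 0 < q)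
    (hn : n + 1 = 729 * q) (hd : 5 * d + 1 = 711 * q)
    (hper : ∀ j, y (j + (4 * l + 6)) = y j)
    (hstep : ∀ j, (6 * y j ≤ n ∧ y (j + 1) = 3 * y j) ∨
      (n ≤ 6 * y j ∧ 3 * y j ≤ n ∧ y (j + 1) = n - 3 * y j) ∨
      (n ≤ 3 * y j ∧ y (j + 1) = 3 * y j - n))
    (hge : ∀ j, d ≤ y j) : ∃ j, y j = d ∨ 4 * y j = n ∨ 2 * y j = n := by
  by_contra! hne
  -- With `y j = (n - e)/5` and `0 < e < 18q`, the orbit continues `(2n + 3e)/5`, `(n + 9e)/5`, `(2n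
  -- - 27e)/5`, and then `|n - 81e|/5`, which is below `n/5` because `81 * 18q = 2(n + 1)`.
  have hstep2 (j : ℕ) (hj : 5 * y j < n) : n < 5 * y (j + 2) ∧ 5 * y (j + 4) < n := by
    have := hne j
    have h0 := hge j
    have := hge (j + 4)
    have h1 := hstep j
    have h2 := hstep (j + 1)
    have h3 := hstep (j + 2)
    have h4 := hstep (j + 3)
    simp only [add_assoc, Nat.reduceAdd] at h1 h2 h3 h4
    have e1 : y (j + 1) = n - 3 * y j := by omega
    have e2 : y (j + 2) = 3 * y (j + 1) - n := by omega
    have e3 : y (j + 3) = n - 3 * y (j + 2) := by omega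
    omega
  have hnot (j : ℕ) : n ≤ 5 * y j := by
    by_contra! hj
    have hall (k : ℕ) : 5 * y (j + 4 * k) < n := by
      induction k with
      | zero => simpa using hj
      | succ k ih => exact (hstep2 _ ih).2
    -- The period is `4(l + 1) + 2`, so after one full period the orbit is on the wrong side of
    -- `n/5`.
    have h1 := (hstep2 _ (hall (l + 1))).1
    have h2 := hper j
    have e : j + 4 * (l + 1) + 2 = j + (4 * l + 6) := by ring
    rw [e] at h1
    omega
  have hpow : (1 : ℤ) < 3 ^ (4 * l + 6) := one_lt_pow₀ (by norm_num) (by omega)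
  by_cases h : ∃ j, 3 * y j < n
  · obtain ⟨j, hj⟩ := h
    -- A point of `[n/5, n/3)` goes to `n - 3y ≤ 2n/5`. If that image were at least `n/3`, its own
    -- image could be at least `n/5` only for `5y = n`, which fails modulo 5.
    have hall (k : ℕ) : 3 * y (j + k) < n := by
      induction k with
      | zero => simpa using hj
      | succ k ih =>
        have h1 := hstep (j + k)
        have h2 := hstep (j + k + 1)
        have h3 := hnot (j + k)
        have h4 := hnot (j + k + 1)
        have h5 := hnot (j + k + 1 + 1)
        have h6 := hge (j + k + 1)
        rw [← add_assoc]
        omega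
    have hexp (k : ℕ) : 4 * y (j + k) - n = (-3) ^ k * (4 * y j - n) := by
      induction k with
      | zero => simp
      | succ k ih =>
        have h1 := hstep (j + k)
        have h2 := hall k
        have h3 := hge (j + k)
        rw [pow_succ, mul_right_comm, ← ih, ← add_assoc]
        omega
    have h1 := hexp (4 * l + 6)
    -- The distance to the fixed point `n/4` is multiplied by `-3` at each step; after a full period
    -- it must be unchanged, hence zero.
    rw [hper, Even.neg_pow ⟨2 * l + 3, by ring⟩] at h1
    have := (hne j).2.1
    have h2 : (3 ^ (4 * l + 6) - 1) * (4 * y j - n) = 0 := by linear_combination -h1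
    rcases mul_eq_zero.1 h2 with h2 | h2
    · exact hpow.ne' (sub_eq_zero.1 h2)
    · exact this (sub_eq_zero.1 h2)
  · push Not at h
    have hexp (k : ℕ) : n - 2 * y k = 3 ^ k * (n - 2 * y 0) := by
      induction k with
      | zero => simp
      | succ k ih =>
        have h1 := hstep k
        have h2 := h k
        rw [pow_succ, mul_right_comm, ← ih]
        omega
    have h1 := hexp (4 * l + 6)
    have h3 := hper 0
    rw [zero_add] at h3
    rw [h3] at h1
    have := (hne 0).2.2
    have h2 : (3 ^ (4 * l + 6) - 1) * (n - 2 * y 0) = 0 := by linear_combination -h1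
    rcases mul_eq_zero.1 h2 with h2 | h2
    · exact hpow.ne' (sub_eq_zero.1 h2)
    · exact this (sub_eq_zero.1 h2).symm

theorem exists_mul_three_pow_eq_of_forall_le {l n d : ℕ} (hn : n + 1 = 3 ^ (4 * l + 6))
    (hd : 5 * d + 1 = 711 * 3 ^ (4 * l)) (s : ZMod n)
    (hs : ∀ j : ℕ, (d : ℤ) ≤ |(s * 3 ^ j).valMinAbs|) :
    ∃ j : ℕ, ∃ t : ℕ, (t = d ∨ 4 * t = n ∨ 2 * t = n) ∧
      (s * 3 ^ j = t ∨ s * 3 ^ j = -t) := by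
  have hq : 0 < 3 ^ (4 * l) := by positivity
  have hn' : n + 1 = 729 * 3 ^ (4 * l) := by rw [hn, pow_add]; ring
  have : NeZero n := ⟨by omega⟩
  have h3 : (3 : ZMod n) ^ (4 * l + 6) = 1 := by
    have := congrArg (Nat.cast : ℕ → ZMod n) hn
    push_cast at this
    simpa using this.symm
  obtain ⟨j, hj⟩ := exists_eq_of_forall_le_folded_tripling (q := 3 ^ (4 * l)) (n := n) (d := d)
    (l := l) (fun j ↦ |(s * 3 ^ j).valMinAbs|) (by exact_mod_cast hq) (by exact_mod_cast hn')
    (by exact_mod_cast hd) (fun j ↦ by simp only [pow_add _ j, h3, mul_one])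
    (fun j ↦ ZMod.abs_valMinAbs_three_mul (s * 3 ^ j) rfl (by
      simp only [pow_succ, mul_comm (3 : ZMod n), mul_assoc])) hs
  refine ⟨j, (s * 3 ^ j).valMinAbs.natAbs, ?_, ?_⟩
  · simp only [Int.abs_eq_natAbs] at hj
    omega
  · have h := (s * 3 ^ j).coe_valMinAbs
    rcases Int.natAbs_eq (s * 3 ^ j).valMinAbs with e | e
    · left
      nth_rw 1 [← h]
      nth_rw 1 [e]
      simp
    · right
      nth_rw 1 [← h]
      nth_rw 1 [e]
      simp

/-! ### Cyclotomic cosets modulo `3 ^ m - 1` and the coset of `d` -/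

theorem mem_cyclotomicCoset_self (q n : ℕ) (s : ZMod n) : s ∈ cyclotomicCoset q n s :=
  ⟨0, by simp⟩

theorem mul_mem_cyclotomicCoset {q n : ℕ} {s i : ZMod n} (h : i ∈ cyclotomicCoset q n s) :
    i * q ∈ cyclotomicCoset q n s := by
  obtain ⟨j, rfl⟩ := h
  exact ⟨j + 1, by rw [pow_succ, mul_assoc]⟩

theorem mem_cyclotomicCoset_of_mul_pow_eq {q n m : ℕ} {s t : ZMod n} (hq : (q : ZMod n) ^ m = 1)
    (hm : 0 < m) {j : ℕ} (h : s * (q : ZMod n) ^ j = t) : s ∈ cyclotomicCoset q n t := by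
  refine ⟨(m - 1) * j, ?_⟩
  rw [← h, mul_assoc, ← pow_add, show j + (m - 1) * j = m * j by
    rw [← Nat.succ_pred_eq_of_pos hm]; simp; ring, pow_mul, hq, one_pow, mul_one]

theorem three_pow_cast_eq_one {n m : ℕ} (hn : n + 1 = 3 ^ m) : (3 : ZMod n) ^ m = 1 := by
  have := congrArg (Nat.cast : ℕ → ZMod n) hn
  push_cast at this
  simpa using this.symm

theorem three_pow_cast_mod {n m : ℕ} (hn : n + 1 = 3 ^ m) (j : ℕ) :
    (3 : ZMod n) ^ (j % m) = 3 ^ j := by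
  nth_rw 2 [← Nat.mod_add_div j m]
  rw [pow_add, pow_mul, three_pow_cast_eq_one hn, one_pow, mul_one]

theorem exists_three_pow_mul_eq_one {n m : ℕ} (hn : n + 1 = 3 ^ m) (hm : 0 < m) (j : ℕ) :
    ∃ e : ℕ, (3 : ZMod n) ^ j * 3 ^ e = 1 := by
  refine ⟨(m - 1) * j, ?_⟩
  obtain ⟨m, rfl⟩ := Nat.exists_eq_succ_of_ne_zero hm.ne'
  rw [← pow_add, show j + (m + 1 - 1) * j = (m + 1) * j by simp; ring, pow_mul,
    three_pow_cast_eq_one hn, one_pow]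

/-- Multiplication by 5 turns the coset of `d` into `-2` times powers of 3, so questions about it
become size estimates on powers of 3. -/
theorem five_mul_cast {l n d : ℕ} (hn : n + 1 = 3 ^ (4 * l + 6))
    (hd : 5 * d + 1 = 711 * 3 ^ (4 * l)) : (5 : ZMod n) * d = -(2 * 3 ^ (4 * l + 2)) := by
  have h : 5 * d + 2 * 3 ^ (4 * l + 2) = n := by
    rw [pow_add] at hn ⊢
    omega
  have := congrArg (Nat.cast : ℕ → ZMod n) h
  push_cast at this
  rw [ZMod.natCast_self] at this
  linear_combination this

theorem three_mul_three_pow_le {n m k : ℕ} (hn : n + 1 = 3 ^ m) (hk : k < m) :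
    3 * 3 ^ k ≤ n + 1 := by
  rw [hn, ← pow_succ']
  exact Nat.pow_le_pow_right (by norm_num) hk

/-- The coset of `d` contains no residue of absolute value less than `d`. -/
theorem intCast_mul_three_pow_ne {l n d : ℕ} (hn : n + 1 = 3 ^ (4 * l + 6))
    (hd : 5 * d + 1 = 711 * 3 ^ (4 * l)) {u : ℤ} (hu : |u| < d) (j : ℕ) :
    (u : ZMod n) * 3 ^ j ≠ d := by
  intro h
  obtain ⟨e, he⟩ := exists_three_pow_mul_eq_one hn (by omega) j
  obtain ⟨k, hk, hk'⟩ : ∃ k < 4 * l + 6, (3 : ZMod n) ^ k = 3 ^ (4 * l + 2 + e) :=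
    ⟨_, Nat.mod_lt _ (by omega), three_pow_cast_mod hn _⟩
  -- The size bounds leave `5u + 2 * 3 ^ k = 0` or `n`. The first fails modulo 5. The second needs
  -- `k ≡ 2` modulo 4, hence `k ≤ 4l + 2` and `5u ≥ n - 18q = 5d`.
  have h5 : ((5 * u + 2 * 3 ^ k : ℤ) : ZMod n) = 0 := by
    push_cast
    rw [hk', pow_add]
    linear_combination (-5 * u) * he + 5 * 3 ^ e * h + 3 ^ e * five_mul_cast hn hd
  rw [ZMod.intCast_zmod_eq_zero_iff_dvd] at h5
  obtain ⟨t, ht⟩ := h5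
  have h3 := three_mul_three_pow_le hn hk
  have hq : 0 < 3 ^ (4 * l) := by positivity
  have hk0 : 0 < 3 ^ k := by positivity
  have hn' : n + 1 = 729 * 3 ^ (4 * l) := by rw [hn, pow_add]; ring
  rw [abs_lt] at hu
  zify at h3 hq hk0 hn' hd
  have h3k : (3 : ℤ) ^ k ≤ 9 * 3 ^ (4 * l) ∨ (3 : ℤ) ^ k = 27 * 3 ^ (4 * l) ∨
      (3 : ℤ) ^ k = 81 * 3 ^ (4 * l) ∨ (3 : ℤ) ^ k = 243 * 3 ^ (4 * l) := by
    rcases le_or_gt k (4 * l + 2) with h | h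
    · left
      calc (3 : ℤ) ^ k ≤ 3 ^ (4 * l + 2) := pow_le_pow_right₀ (by norm_num) h
        _ = 9 * 3 ^ (4 * l) := by ring
    · right
      obtain rfl | rfl | rfl : k = 4 * l + 3 ∨ k = 4 * l + 4 ∨ k = 4 * l + 5 := by omega
      · left; ring
      · right; left; ring
      · right; right; ring
  have h5k : (3 : ℤ) ^ k % 5 ≠ 0 := by
    intro h
    have h1 : (5 : ℤ) ∣ 3 := Int.Prime.dvd_pow' (by norm_num) (Int.dvd_of_emod_eq_zero h)
    norm_num at h1
  generalize (3 : ℤ) ^ k = w at *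
  generalize (3 : ℤ) ^ (4 * l) = q at *
  have ht1 : t < 2 := by
    by_contra! h
    nlinarith
  have ht2 : -1 < t := by
    by_contra! h
    nlinarith
  interval_cases t <;> omega

theorem four_mul_cast_ne_zero {l n d : ℕ} (hn : n + 1 = 3 ^ (4 * l + 6))
    (hd : 5 * d + 1 = 711 * 3 ^ (4 * l)) : (4 : ZMod n) * d ≠ 0 := by
  intro h
  have h4 : ((4 * d : ℕ) : ZMod n) = 0 := by exact_mod_cast h
  rw [ZMod.natCast_eq_zero_iff] at h4
  have hq : 0 < 3 ^ (4 * l) := by positivity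
  rw [pow_add] at hn
  exact absurd (Nat.le_of_dvd (by omega) h4) (by omega)

theorem cast_mul_three_pow_ne_self {l n d : ℕ} (hn : n + 1 = 3 ^ (4 * l + 6))
    (hd : 5 * d + 1 = 711 * 3 ^ (4 * l)) {k : ℕ} (hk : k < 4 * l + 6) (hk0 : k ≠ 0) :
    (d : ZMod n) * 3 ^ k ≠ d := by
  intro h
  obtain ⟨e, he⟩ := exists_three_pow_mul_eq_one hn (by omega) (4 * l + 2)
  have h3 := three_mul_three_pow_le hn hk
  have h1 : 1 < 3 ^ k := Nat.one_lt_pow hk0 (by norm_num)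
  -- Multiply by 5 and cancel the unit `3 ^ (4l + 2)`; the resulting integer is positive and smaller
  -- than `n`.
  have h2 : ((2 * (3 ^ k - 1) : ℕ) : ZMod n) = 0 := by
    rw [Nat.cast_mul, Nat.cast_sub h1.le]
    push_cast
    linear_combination (-2 * (3 ^ k - 1)) * he - 3 ^ e * 5 * h +
      3 ^ e * (3 ^ k - 1) * five_mul_cast hn hd
  rw [ZMod.natCast_eq_zero_iff] at h2
  exact absurd (Nat.le_of_dvd (by omega) h2) (by omega)

theorem cast_mul_three_pow_ne_neg {l n d : ℕ} (hn : n + 1 = 3 ^ (4 * l + 6))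
    (hd : 5 * d + 1 = 711 * 3 ^ (4 * l)) (k : ℕ) : (d : ZMod n) * 3 ^ k ≠ -d := by
  rw [← three_pow_cast_mod hn]
  have hk : k % (4 * l + 6) < 4 * l + 6 := Nat.mod_lt _ (by omega)
  generalize k % (4 * l + 6) = k at hk
  intro h
  obtain ⟨e, he⟩ := exists_three_pow_mul_eq_one hn (by omega) (4 * l + 2)
  have h3 := three_mul_three_pow_le hn hk
  have h2 : ((2 * (3 ^ k + 1) : ℕ) : ZMod n) = 0 := by
    push_cast
    linear_combination (-2 * (3 ^ k + 1)) * he - 3 ^ e * 5 * h +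
      3 ^ e * (3 ^ k + 1) * five_mul_cast hn hd
  rw [ZMod.natCast_eq_zero_iff] at h2
  have hq : 0 < 3 ^ (4 * l) := by positivity
  rw [pow_add] at hn
  exact absurd (Nat.le_of_dvd (by omega) h2) (by omega)

/-! ### The defining set and its complement -/

/-- The union of the ternary cyclotomic cosets of all `s` with `|s| < d`, of `d₁` and of `d₂`. -/
def symmetricDefiningSet (n d₁ d₂ d : ℕ) : Set (ZMod n) :=
  {i | ∃ s : ℤ, |s| < (d : ℤ) ∧ i ∈ cyclotomicCoset 3 n (s : ZMod n)}
    ∪ cyclotomicCoset 3 n (d₁ : ZMod n) ∪ cyclotomicCoset 3 n (d₂ : ZMod n)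

theorem mul_three_mem_symmetricDefiningSet {n d₁ d₂ d : ℕ} {i : ZMod n}
    (h : i ∈ symmetricDefiningSet n d₁ d₂ d) : i * 3 ∈ symmetricDefiningSet n d₁ d₂ d := by
  rcases h with (⟨s, hs, h⟩ | h) | h
  · exact .inl (.inl ⟨s, hs, by simpa using mul_mem_cyclotomicCoset h⟩)
  · exact .inl (.inr (by simpa using mul_mem_cyclotomicCoset h))
  · exact .inr (by simpa using mul_mem_cyclotomicCoset h)

theorem notMem_symmetricDefiningSet_iff {l n d₁ d₂ d : ℕ} (hn : n + 1 = 3 ^ (4 * l + 6))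
    (hd : 5 * d + 1 = 711 * 3 ^ (4 * l)) (hd₁ : 2 * d₁ = n) (hd₂ : 4 * d₂ = n) {i : ZMod n} :
    i ∉ symmetricDefiningSet n d₁ d₂ d ↔ ∃ k : ℕ, i = d * 3 ^ k ∨ i = -(d * 3 ^ k) := by
  have hone : ((3 : ℕ) : ZMod n) ^ (4 * l + 6) = 1 := by
    simpa using three_pow_cast_eq_one hn
  have h1 : (2 : ZMod n) * d₁ = 0 := by
    exact_mod_cast (congrArg (Nat.cast : ℕ → ZMod n) hd₁).trans (CharP.cast_eq_zero _ _)
  have h2 : (4 : ZMod n) * d₂ = 0 := by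
    exact_mod_cast (congrArg (Nat.cast : ℕ → ZMod n) hd₂).trans (CharP.cast_eq_zero _ _)
  constructor
  · intro hi
    have hge (j : ℕ) : (d : ℤ) ≤ |(i * 3 ^ j).valMinAbs| := by
      by_contra! h
      exact hi (.inl (.inl ⟨_, h, mem_cyclotomicCoset_of_mul_pow_eq (j := j) hone (by omega)
        (by simp)⟩))
    obtain ⟨j, t, ht, hj⟩ := exists_mul_three_pow_eq_of_forall_le hn hd i hge
    obtain ⟨e, he⟩ := exists_three_pow_mul_eq_one hn (by omega) j
    rcases ht with rfl | ht | ht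
    · refine ⟨e, hj.imp (fun h ↦ ?_) fun h ↦ ?_⟩
      · linear_combination 3 ^ e * h - i * he
      · linear_combination 3 ^ e * h - i * he
    · obtain rfl : t = d₂ := by omega
      refine absurd (Or.inr ?_) hi
      rcases hj with hj | hj
      · exact mem_cyclotomicCoset_of_mul_pow_eq (j := j) hone (by omega) (by simpa using hj)
      -- Since `4 * d₂ = 0`, one more tripling takes `-d₂` to `d₂`.
      · refine mem_cyclotomicCoset_of_mul_pow_eq (j := j + 1) hone (by omega) ?_
        push_cast
        linear_combination 3 * hj - h2
    · obtain rfl : t = d₁ := by omega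
      refine absurd (Or.inl (Or.inr ?_)) hi
      refine mem_cyclotomicCoset_of_mul_pow_eq (j := j) hone (by omega) ?_
      push_cast
      rcases hj with hj | hj
      · exact hj
      · linear_combination hj - h1
  · rintro ⟨k, hk⟩ hi
    obtain ⟨e, he⟩ := exists_three_pow_mul_eq_one hn (by omega) k
    rcases hi with (⟨s, hs, j, hj⟩ | ⟨j, hj⟩) | ⟨j, hj⟩ <;> push_cast at hj
    · rcases hk with hk | hk
      · refine intCast_mul_three_pow_ne hn hd hs (j + e) ?_
        rw [pow_add]
        linear_combination d * he - 3 ^ e * hj + 3 ^ e * hk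
      · refine intCast_mul_three_pow_ne hn hd (u := -s) (by simpa using hs) (j + e) ?_
        rw [pow_add]
        push_cast
        linear_combination d * he + 3 ^ e * hj - 3 ^ e * hk
    · refine four_mul_cast_ne_zero hn hd ?_
      rcases hk with hk | hk
      · linear_combination (-4 * d) * he - 4 * 3 ^ e * hk + 4 * 3 ^ e * hj + 2 * 3 ^ j * 3 ^ e * h1
      · linear_combination (-4 * d) * he + 4 * 3 ^ e * hk - 4 * 3 ^ e * hj - 2 * 3 ^ j * 3 ^ e * h1
    · refine four_mul_cast_ne_zero hn hd ?_
      rcases hk with hk | hk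
      · linear_combination (-4 * d) * he - 4 * 3 ^ e * hk + 4 * 3 ^ e * hj + 3 ^ j * 3 ^ e * h2
      · linear_combination (-4 * d) * he + 4 * 3 ^ e * hk - 4 * 3 ^ e * hj - 3 ^ j * 3 ^ e * h2

/-! ### The largest designed distance -/

theorem bchDefiningSet_neg_subset (n d₁ d₂ d : ℕ) :
    bchDefiningSet 3 n (2 * d) (-(d : ℤ)) ⊆ symmetricDefiningSet n d₁ d₂ d := by
  rintro i ⟨k, hk1, hk2, hi⟩
  exact .inl (.inl ⟨_, abs_lt.2 ⟨by omega, by omega⟩, hi⟩)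

/-- The excluded residues `d`, `n - 3d`, `n - d`, `n + d` have successive gaps `n - 4d`, `2d`, `2d`,
all at most `2d` because `n ≤ 6d`. So `2d` consecutive integers always meet the complement. -/
theorem le_of_bchDefiningSet_subset {l n d₁ d₂ d : ℕ} (hn : n + 1 = 3 ^ (4 * l + 6))
    (hd : 5 * d + 1 = 711 * 3 ^ (4 * l)) (hd₁ : 2 * d₁ = n) (hd₂ : 4 * d₂ = n) {D : ℕ} {b : ℤ}
    (h : bchDefiningSet 3 n D b ⊆ symmetricDefiningSet n d₁ d₂ d) : D ≤ 2 * d := by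
  by_contra! hD
  have hmem (x : ℤ) (h1 : b + 1 ≤ x) (h2 : x ≤ b + 2 * d) :
      (x : ZMod n) ∈ symmetricDefiningSet n d₁ d₂ d := by
    refine h ⟨(x - b).toNat, by omega, by omega, ?_⟩
    rw [show b + ((x - b).toNat : ℤ) = x by omega]
    exact mem_cyclotomicCoset_self _ _ _
  have hnot {x : ZMod n} (hx : ∃ k : ℕ, x = d * 3 ^ k ∨ x = -(d * 3 ^ k)) :
      x ∉ symmetricDefiningSet n d₁ d₂ d := (notMem_symmetricDefiningSet_iff hn hd hd₁ hd₂).2 hx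
  have hq : 0 < 3 ^ (4 * l) := by positivity
  have hn' : n + 1 = 729 * 3 ^ (4 * l) := by rw [hn, pow_add]; ring
  clear hn
  generalize 3 ^ (4 * l) = q at *
  have hn6 : n ≤ 6 * d := by linarith
  have hn0 : 0 < n := by linarith
  zify at hn0
  clear hn' hd hd₁ hd₂
  have hdiv := Int.emod_add_mul_ediv (b + 1) n
  have hr0 := Int.emod_nonneg (b + 1) hn0.ne'
  have hr1 := Int.emod_lt_of_pos (b + 1) hn0
  generalize (b + 1) % n = r at *
  obtain ⟨e, he⟩ : ∃ e : ℤ, e = n * ((b + 1) / n) := ⟨_, rfl⟩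
  have he' : (e : ZMod n) = 0 := by rw [he]; simp
  rw [← he] at hdiv
  clear he
  rcases le_or_gt r d with h1 | h1
  · exact hnot ⟨0, .inl (by simp [he'])⟩ (hmem (d + e) (by omega) (by omega))
  rcases le_or_gt r (n - 3 * d) with h2 | h2
  · exact hnot ⟨1, .inr (by simp [he', mul_comm])⟩ (hmem (n - 3 * d + e) (by omega) (by omega))
  rcases le_or_gt r (n - d) with h3 | h3
  · exact hnot ⟨0, .inr (by simp [he'])⟩ (hmem (n - d + e) (by omega) (by omega))
  · exact hnot ⟨0, .inl (by simp [he'])⟩ (hmem (n + d + e) (by omega) (by omega))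

/-! ### Generator polynomials and cyclic codes -/

theorem zeroPolynomial_monic {F : Type*} [Field F] (n : ℕ) (α : F) (Z : Set (ZMod n)) :
    (zeroPolynomial n α Z).Monic :=
  monic_prod_of_monic _ _ fun _ _ ↦ monic_X_sub_C _

theorem pow_eq_pow_of_cast_eq {M : Type*} [Monoid M] {n : ℕ} {α : M} (h : α ^ n = 1) {a b : ℕ}
    (hab : (a : ZMod n) = b) : α ^ a = α ^ b := by
  rw [ZMod.natCast_eq_natCast_iff] at hab
  rw [pow_eq_pow_mod a h, hab, ← pow_eq_pow_mod b h]

theorem cast_eq_cast_of_pow_eq_pow {F : Type*} [Field F] {n : ℕ} {α : F} (hα : IsPrimitiveRoot α n)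
    (hn : n ≠ 0) {a b : ℕ} (h : α ^ a = α ^ b) : (a : ZMod n) = b := by
  rw [pow_eq_pow_mod a hα.pow_eq_one, pow_eq_pow_mod b hα.pow_eq_one] at h
  rw [ZMod.natCast_eq_natCast_iff]
  exact hα.pow_inj (Nat.mod_lt _ (Nat.pos_of_ne_zero hn)) (Nat.mod_lt _ (Nat.pos_of_ne_zero hn)) h

theorem zeroPolynomial_dvd_iff {F : Type*} [Field F] {n : ℕ} {α : F} (hα : IsPrimitiveRoot α n)
    (hn : n ≠ 0) {Z : Set (ZMod n)} {f : F[X]} :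
    zeroPolynomial n α Z ∣ f ↔ ∀ k : ℕ, (k : ZMod n) ∈ Z → f.eval (α ^ k) = 0 := by
  classical
  constructor
  · intro h k hk
    refine eval_eq_zero_of_dvd_of_eval_eq_zero h ?_
    rw [zeroPolynomial, eval_prod]
    refine Finset.prod_eq_zero (i := k % n) ?_ ?_
    · simpa [Nat.mod_lt _ (Nat.pos_of_ne_zero hn)] using hk
    · simp [pow_eq_pow_of_cast_eq hα.pow_eq_one (a := k % n) (b := k) (by simp)]
  · intro h
    rw [zeroPolynomial]
    refine Finset.prod_dvd_of_coprime ?_ ?_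
    · intro i hi j hj hij
      refine isCoprime_X_sub_C_of_isUnit_sub (sub_ne_zero.2 fun he ↦ hij ?_).isUnit
      simp only [Finset.coe_filter, Finset.mem_range, Set.mem_ofPred_eq] at hi hj
      exact hα.pow_inj hi.1 hj.1 he
    · intro i hi
      rw [dvd_iff_isRoot]
      exact h i (by simpa using (Finset.mem_filter.1 hi).2)

/-- Frobenius permutes the roots, so it fixes the coefficients, which therefore lie in the prime
field. -/
theorem exists_map_eq_zeroPolynomial {F : Type*} [Field F] {p : ℕ} [Fact p.Prime]
    [Algebra (ZMod p) F] {n : ℕ} {α : F} (hα : IsPrimitiveRoot α n) (hn : n ≠ 0)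
    {Z : Set (ZMod n)} (hZ : ∀ i ∈ Z, ∃ j ∈ Z, j * p = i) :
    ∃ g : (ZMod p)[X], g.map (algebraMap (ZMod p) F) = zeroPolynomial n α Z := by
  have : CharP F p := charP_of_injective_algebraMap (algebraMap (ZMod p) F).injective p
  have : NeZero n := ⟨hn⟩
  have hmonic := zeroPolynomial_monic n α Z
  have hfrob : (zeroPolynomial n α Z).map (frobenius F p) = zeroPolynomial n α Z := by
    refine eq_of_monic_of_dvd_of_natDegree_le hmonic (hmonic.map _) ?_
      (natDegree_map _).le
    rw [zeroPolynomial_dvd_iff hα hn]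
    intro k hk
    obtain ⟨j, hj, hjk⟩ := hZ _ hk
    have h1 : α ^ k = frobenius F p (α ^ j.val) := by
      rw [frobenius_def, ← pow_mul]
      exact pow_eq_pow_of_cast_eq hα.pow_eq_one (by simp [hjk])
    rw [h1, eval_map_apply, (zeroPolynomial_dvd_iff hα hn).1 dvd_rfl _ (by simpa using hj),
      map_zero]
  refine (mem_lifts _).1 ((lifts_iff_coeff_lifts _).2 fun k ↦ ?_)
  have h1 := congrArg (fun f ↦ f.coeff k) hfrob
  rw [coeff_map, frobenius_def, ← Subfield.mem_bot_iff_pow_eq_self,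
    mem_bot_iff_intCast p] at h1
  obtain ⟨z, hz⟩ := h1
  exact ⟨z, by simpa using hz⟩

theorem mem_cyclicCode_iff_dvd {K : Type*} [Field K] {n : ℕ} {g : K[X]} (hg : g ∣ X ^ n - 1)
    {c : Fin n → K} : c ∈ cyclicCode n g ↔ g ∣ wordPolynomial K n c := by
  change AdjoinRoot.mk _ (wordPolynomial K n c) ∈ Ideal.span {_} ↔ _
  rw [Ideal.mem_span_singleton]
  refine ⟨fun h ↦ ?_, fun h ↦ map_dvd _ h⟩
  obtain ⟨h, hh⟩ := h
  obtain ⟨h, rfl⟩ := AdjoinRoot.mk_surjective h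
  rw [← map_mul, AdjoinRoot.mk_eq_mk] at hh
  have := (hg.trans hh).add (dvd_mul_right g h)
  rwa [sub_add_cancel] at this

theorem aeval_wordPolynomial {K F : Type*} [Field K] [Field F] [Algebra K F] {n : ℕ}
    (c : Fin n → K) (x : F) :
    aeval x (wordPolynomial K n c) = ∑ i, algebraMap K F (c i) * x ^ (i : ℕ) := by
  simp [wordPolynomial, aeval_monomial]

theorem mem_cyclicCode_iff {K F : Type*} [Field K] [Field F] [Algebra K F] {n : ℕ} {α : F}
    (hα : IsPrimitiveRoot α n) (hn : n ≠ 0) {Z : Set (ZMod n)} {g : K[X]} (hg : g ∣ X ^ n - 1)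
    (hgZ : g.map (algebraMap K F) = zeroPolynomial n α Z) {c : Fin n → K} :
    c ∈ cyclicCode n g ↔
      ∀ k : ℕ, (k : ZMod n) ∈ Z → aeval (α ^ k) (wordPolynomial K n c) = 0 := by
  rw [mem_cyclicCode_iff_dvd hg, ← map_dvd_map' (algebraMap K F), hgZ,
    zeroPolynomial_dvd_iff hα hn]
  simp only [eval_map_algebraMap]

/-! ### The BCH bound -/

/-- The BCH bound. -/
theorem lt_hammingNorm_of_aeval_eq_zero {K F : Type*} [Field K] [DecidableEq K] [Field F]
    [Algebra K F] {n : ℕ} {α : F} (hα : IsPrimitiveRoot α n) {c : Fin n → K} (hc : c ≠ 0)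
    {b D : ℕ} (h : ∀ k < D, aeval (α ^ (b + k)) (wordPolynomial K n c) = 0) :
    D < hammingNorm c := by
  classical
  by_contra! hD
  obtain ⟨j, hj⟩ := Function.ne_iff.1 hc
  have hn : n ≠ 0 := j.pos.ne'
  set S : Finset (Fin n) := Finset.univ.filter fun i ↦ c i ≠ 0 with hS
  have hjS : j ∈ S := by simpa [hS] using hj
  -- In place of a Vandermonde determinant: `P` kills every support position except `j`. If the
  -- weight is at most `D`, then `deg P < D`, and combining the `D` vanishing conditions with the
  -- coefficients of `P` isolates `c j`.
  set P : F[X] := ∏ i ∈ S.erase j, (X - C (α ^ (i : ℕ))) with hP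
  have hdeg : P.natDegree < D := by
    rw [hP, natDegree_prod_of_monic _ _ fun _ _ ↦ monic_X_sub_C _]
    simp only [natDegree_X_sub_C, Finset.sum_const, smul_eq_mul, mul_one]
    exact (Finset.card_erase_lt_of_mem hjS).trans_le hD
  have h0 : ∑ i, algebraMap K F (c i) * α ^ (b * i) * P.eval (α ^ (i : ℕ)) = 0 := by
    simp only [eval_eq_sum_range' hdeg, Finset.mul_sum]
    rw [Finset.sum_comm]
    refine Finset.sum_eq_zero fun k hk ↦ ?_
    have := h k (Finset.mem_range.1 hk)
    rw [aeval_wordPolynomial] at this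
    rw [← mul_zero (P.coeff k), ← this, Finset.mul_sum]
    refine Finset.sum_congr rfl fun i _ ↦ ?_
    ring
  rw [Finset.sum_eq_single j] at h0
  · refine (mul_ne_zero (mul_ne_zero ?_ (pow_ne_zero _ (hα.ne_zero hn))) ?_) h0
    · simpa using hj
    · rw [hP, eval_prod, Finset.prod_ne_zero_iff]
      intro i hi
      simp only [eval_sub, eval_X, eval_C]
      refine sub_ne_zero.2 fun he ↦ Finset.ne_of_mem_erase hi ?_
      exact Fin.ext (hα.pow_inj i.2 j.2 he.symm)
  · intro i _ hij
    by_cases hi : c i = 0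
    · simp [hi]
    · rw [hP, eval_prod, Finset.prod_eq_zero (i := i), mul_zero]
      · simp [hS, hij, hi]
      · simp
  · simp

/-- With `n` consecutive zeros the BCH bound would force weight above `n`. -/
theorem eq_zero_of_forall_aeval_eq_zero {K F : Type*} [Field K] [Field F]
    [Algebra K F] {n : ℕ} {α : F} (hα : IsPrimitiveRoot α n) {c : Fin n → K}
    (h : ∀ k : ℕ, aeval (α ^ k) (wordPolynomial K n c) = 0) : c = 0 := by
  classical
  by_contra hc
  have := lt_hammingNorm_of_aeval_eq_zero hα hc (b := 0) (D := n) fun k _ ↦ h _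
  exact this.not_ge (by simpa using hammingNorm_le_card_fintype (x := c))

/-! ### Trace words and their Fourier transform -/

theorem sum_pow_eq_ite {F : Type*} [Field F] [DecidableEq F] {n : ℕ} {y : F} (hy : y ^ n = 1) :
    ∑ i : Fin n, y ^ (i : ℕ) = if y = 1 then (n : F) else 0 := by
  rw [Fin.sum_univ_eq_sum_range (fun i ↦ y ^ i)]
  split_ifs with h
  · simp [h]
  · rw [geom_sum_eq h, hy, sub_self, zero_div]

theorem add_pow_card_pow (K : Type*) {F : Type*} [Field K] [Fintype K] [Field F] [Algebra K F]
    (u v : F) (k : ℕ) : (u + v) ^ Fintype.card K ^ k =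
      u ^ Fintype.card K ^ k + v ^ Fintype.card K ^ k := by
  induction k with
  | zero => simp
  | succ k ih =>
    simp only [pow_succ, pow_mul, ih]
    exact map_add (FiniteField.frobeniusAlgHom K F) _ _

theorem aeval_pow_card {K F : Type*} [Field K] [Fintype K] [Field F] [Algebra K F] (p : K[X])
    (x : F) : aeval (x ^ Fintype.card K) p = aeval x p ^ Fintype.card K :=
  aeval_algHom_apply (FiniteField.frobeniusAlgHom K F) x p

theorem aeval_pow_card_pow {K F : Type*} [Field K] [Fintype K] [Field F] [Algebra K F] (p : K[X])
    (x : F) (k : ℕ) :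
    aeval (x ^ Fintype.card K ^ k) p = aeval x p ^ Fintype.card K ^ k := by
  induction k with
  | zero => simp
  | succ k ih => rw [pow_succ, pow_mul, aeval_pow_card, ih, ← pow_mul]

/-- The word with entries `Tr (a β ^ i + b β ^ (-i))`. -/
noncomputable def traceWord (K : Type*) {F : Type*} [Field K] [Field F] [Algebra K F] (n : ℕ)
    (β : F) : F × F →ₗ[K] (Fin n → K) where
  toFun ab i := Algebra.trace K F (ab.1 * β ^ (i : ℕ) + ab.2 * β⁻¹ ^ (i : ℕ))
  map_add' x y := by
    ext i
    simp only [Prod.fst_add, Prod.snd_add, Pi.add_apply, ← map_add]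
    congr 1
    ring
  map_smul' r x := by
    ext i
    simp only [Prod.smul_fst, Prod.smul_snd, smul_mul_assoc, ← smul_add, map_smul,
      RingHom.id_apply, Pi.smul_apply]

theorem traceWord_apply {K F : Type*} [Field K] [Field F] [Algebra K F] (n : ℕ)
    (β a b : F) (i : Fin n) : traceWord K n β (a, b) i =
      Algebra.trace K F (a * β ^ (i : ℕ) + b * β⁻¹ ^ (i : ℕ)) := rfl

/-- Expanding the trace as a sum of conjugates leaves geometric sums over `n`-th roots of unity.
Thus the transform is supported on the inverses of the conjugates of `β` and `β⁻¹`. -/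
theorem aeval_wordPolynomial_traceWord {K F : Type*} [Field K] [Fintype K] [Field F] [Finite F]
    [Algebra K F] [DecidableEq F] {n : ℕ} {β x : F} (hβ : β ^ n = 1) (hx : x ^ n = 1) (a b : F) :
    aeval x (wordPolynomial K n (traceWord K n β (a, b))) =
      ∑ k ∈ Finset.range (Module.finrank K F),
        (a ^ Fintype.card K ^ k * (if β ^ Fintype.card K ^ k * x = 1 then (n : F) else 0) +
          b ^ Fintype.card K ^ k * (if β⁻¹ ^ Fintype.card K ^ k * x = 1 then (n : F) else 0)) := by
  have h (γ : F) (hγ : γ ^ n = 1) (k : ℕ) :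
      (if γ ^ k * x = 1 then (n : F) else 0) = ∑ i : Fin n, (γ ^ k * x) ^ (i : ℕ) :=
    (sum_pow_eq_ite (by rw [mul_pow, hx, pow_right_comm, hγ, one_pow, one_mul])).symm
  rw [aeval_wordPolynomial]
  simp only [traceWord_apply, FiniteField.algebraMap_trace_eq_sum_pow, h β hβ,
    h β⁻¹ (by rw [inv_pow, hβ, inv_one]), Finset.mul_sum, Finset.sum_mul,
    ← Finset.sum_add_distrib]
  rw [Finset.sum_comm]
  refine Finset.sum_congr rfl fun k _ ↦ Finset.sum_congr rfl fun i _ ↦ ?_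
  simp only [Nat.card_eq_fintype_card, add_pow_card_pow]
  ring

theorem traceWord_swap {K F : Type*} [Field K] [Field F] [Algebra K F] (n : ℕ) (β a b : F) :
    traceWord K n β (a, b) = traceWord K n β⁻¹ (b, a) := by
  ext i
  simp only [traceWord_apply, inv_inv, add_comm]

/-- Fourier inversion: `h1` (full orbit) and `h2` (`β⁻¹` is not conjugate to `β`) leave only the
term `k = 0`, so `a` can be recovered. -/
theorem aeval_inv_wordPolynomial_traceWord {K F : Type*} [Field K] [Fintype K] [Field F] [Finite F]
    [Algebra K F] {n : ℕ} {β : F} (hβ : β ^ n = 1) (hβ0 : β ≠ 0)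
    (h1 : ∀ k < Module.finrank K F, β ^ Fintype.card K ^ k = β → k = 0)
    (h2 : ∀ k, β ^ Fintype.card K ^ k ≠ β⁻¹) (a b : F) :
    aeval β⁻¹ (wordPolynomial K n (traceWord K n β (a, b))) = a * n := by
  classical
  rw [aeval_wordPolynomial_traceWord hβ (by rw [inv_pow, hβ, inv_one]),
    Finset.sum_eq_single_of_mem 0 (Finset.mem_range.2 Module.finrank_pos)]
  · have := h2 0
    simp only [pow_zero, pow_one] at this
    simp [hβ0, mul_inv_eq_one₀, this.symm]
  · intro k hk hk0
    have h3 : β ^ Fintype.card K ^ k ≠ β := fun h ↦ hk0 (h1 k (Finset.mem_range.1 hk) h)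
    have h4 : β⁻¹ ^ Fintype.card K ^ k ≠ β := fun h ↦ h2 k (by
      rw [← inv_inj, inv_inv, ← inv_pow, h])
    simp only [mul_inv_eq_one₀ hβ0, if_neg h3, if_neg h4, mul_zero, add_zero]

theorem aeval_self_wordPolynomial_traceWord {K F : Type*} [Field K] [Fintype K] [Field F] [Finite F]
    [Algebra K F] {n : ℕ} {β : F} (hβ : β ^ n = 1) (hβ0 : β ≠ 0)
    (h1 : ∀ k < Module.finrank K F, β ^ Fintype.card K ^ k = β → k = 0)
    (h2 : ∀ k, β ^ Fintype.card K ^ k ≠ β⁻¹) (a b : F) :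
    aeval β (wordPolynomial K n (traceWord K n β (a, b))) = b * n := by
  rw [traceWord_swap, ← aeval_inv_wordPolynomial_traceWord (K := K) (β := β⁻¹) (n := n)
    (by rw [inv_pow, hβ, inv_one]) (inv_ne_zero hβ0) (fun k hk h ↦ h1 k hk ?_)
    (fun k h ↦ h2 k ?_) b a]
  · rw [inv_inv]
  · simpa using h
  · rw [inv_inv] at h
    rw [← inv_inj, inv_inv, ← inv_pow, h]

theorem traceWord_injective {K F : Type*} [Field K] [Fintype K] [Field F] [Finite F]
    [Algebra K F] {n : ℕ} (hnF : (n : F) ≠ 0) {β : F} (hβ : β ^ n = 1) (hβ0 : β ≠ 0)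
    (h1 : ∀ k < Module.finrank K F, β ^ Fintype.card K ^ k = β → k = 0)
    (h2 : ∀ k, β ^ Fintype.card K ^ k ≠ β⁻¹) : Function.Injective (traceWord K n β) := by
  rw [injective_iff_map_eq_zero]
  rintro ⟨a, b⟩ h
  have ha := aeval_inv_wordPolynomial_traceWord hβ hβ0 h1 h2 a b
  have hb := aeval_self_wordPolynomial_traceWord hβ hβ0 h1 h2 a b
  rw [h, map_zero, map_zero] at ha hb
  exact Prod.ext ((mul_eq_zero.1 ha.symm).resolve_right hnF)
    ((mul_eq_zero.1 hb.symm).resolve_right hnF)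

/-- A word of a cyclic code whose nonzeros are the conjugates of `β` and of `β⁻¹` vanishes once
it vanishes at `β` and `β⁻¹`. -/
theorem eq_zero_of_mem_cyclicCode {K F : Type*} [Field K] [Fintype K] [Field F]
    [Algebra K F] {n : ℕ} (hn : n ≠ 0) {α β : F} (hα : IsPrimitiveRoot α n) {Z : Set (ZMod n)}
    {g : K[X]} (hg : g ∣ X ^ n - 1) (hgZ : g.map (algebraMap K F) = zeroPolynomial n α Z)
    (hZ : ∀ k : ℕ, (k : ZMod n) ∉ Z ↔
      ∃ j, α ^ k = β ^ Fintype.card K ^ j ∨ α ^ k = β⁻¹ ^ Fintype.card K ^ j)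
    {c : Fin n → K} (hc : c ∈ cyclicCode n g) (h : aeval β (wordPolynomial K n c) = 0)
    (h' : aeval β⁻¹ (wordPolynomial K n c) = 0) : c = 0 := by
  refine eq_zero_of_forall_aeval_eq_zero hα fun k ↦ ?_
  by_cases hk : (k : ZMod n) ∈ Z
  · exact (mem_cyclicCode_iff hα hn hg hgZ).1 hc k hk
  · have h0 (j : ℕ) : Fintype.card K ^ j ≠ 0 := pow_ne_zero _ Fintype.card_ne_zero
    obtain ⟨j, hj | hj⟩ := (hZ k).1 hk
    · rw [hj, aeval_pow_card_pow, h, zero_pow (h0 j)]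
    · rw [hj, aeval_pow_card_pow, h', zero_pow (h0 j)]

/-- Trace words vanish on `Z`. Conversely, subtracting from a codeword the trace word with the same
values at `β` and `β⁻¹` leaves a codeword vanishing at both, hence zero. -/
theorem cyclicCode_eq_range_traceWord {K F : Type*} [Field K] [Fintype K] [Field F] [Finite F]
    [Algebra K F] {n : ℕ} (hnF : (n : F) ≠ 0) {α β : F} (hα : IsPrimitiveRoot α n)
    (hβ : β ^ n = 1) (hβ0 : β ≠ 0)
    (h1 : ∀ k < Module.finrank K F, β ^ Fintype.card K ^ k = β → k = 0)
    (h2 : ∀ k, β ^ Fintype.card K ^ k ≠ β⁻¹) {Z : Set (ZMod n)} {g : K[X]} (hg : g ∣ X ^ n - 1)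
    (hgZ : g.map (algebraMap K F) = zeroPolynomial n α Z)
    (hZ : ∀ k : ℕ, (k : ZMod n) ∉ Z ↔
      ∃ j, α ^ k = β ^ Fintype.card K ^ j ∨ α ^ k = β⁻¹ ^ Fintype.card K ^ j) :
    cyclicCode n g = LinearMap.range (traceWord K n β) := by
  classical
  have hn : n ≠ 0 := by
    rintro rfl
    simp at hnF
  have hle : LinearMap.range (traceWord K n β) ≤ cyclicCode n g := by
    rintro _ ⟨⟨a, b⟩, rfl⟩
    rw [mem_cyclicCode_iff hα hn hg hgZ]
    intro k hk
    have hne : ¬∃ j, α ^ k = β ^ Fintype.card K ^ j ∨ α ^ k = β⁻¹ ^ Fintype.card K ^ j :=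
      fun h ↦ (hZ k).2 h hk
    push Not at hne
    rw [aeval_wordPolynomial_traceWord hβ (by rw [pow_right_comm, hα.pow_eq_one, one_pow])]
    refine Finset.sum_eq_zero fun j _ ↦ ?_
    rw [if_neg, if_neg, mul_zero, mul_zero, add_zero]
    · intro h
      refine (hne j).1 ?_
      rw [eq_inv_of_mul_eq_one_right h, inv_pow, inv_inv]
    · intro h
      refine (hne j).2 ?_
      rw [eq_inv_of_mul_eq_one_right h, inv_pow]
  refine le_antisymm (fun c hc ↦ ?_) hle
  set w := traceWord K n β (aeval β⁻¹ (wordPolynomial K n c) / n,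
    aeval β (wordPolynomial K n c) / n) with hw
  have hsub : c - w = 0 := by
    refine eq_zero_of_mem_cyclicCode hn hα hg hgZ hZ (sub_mem hc (hle ⟨_, rfl⟩)) ?_ ?_
    · rw [map_sub, map_sub, hw, aeval_self_wordPolynomial_traceWord hβ hβ0 h1 h2,
        div_mul_cancel₀ _ hnF, sub_self]
    · rw [map_sub, map_sub, hw, aeval_inv_wordPolynomial_traceWord hβ hβ0 h1 h2,
        div_mul_cancel₀ _ hnF, sub_self]
  exact ⟨_, (sub_eq_zero.1 hsub).symm⟩

/-! ### Complementary duality -/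

/-- The inner product with the trace word of `(a, 0)` is `Tr(c(β) a)`, so nondegeneracy of the trace
form applies. -/
theorem aeval_eq_zero_of_forall_sum_mul_traceWord_eq_zero {K F : Type*} [Field K] [Finite K]
    [Field F] [Finite F] [Algebra K F] {n : ℕ} {β : F} {c : Fin n → K}
    (h : ∀ a, ∑ i, c i * traceWord K n β (a, 0) i = 0) :
    aeval β (wordPolynomial K n c) = 0 := by
  refine (traceForm_nondegenerate K F).1 _ fun a ↦ ?_
  rw [Algebra.traceForm_apply, ← h a, aeval_wordPolynomial, Finset.sum_mul, map_sum]
  refine Finset.sum_congr rfl fun i _ ↦ ?_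
  rw [traceWord_apply, zero_mul, add_zero, ← smul_eq_mul (c i), ← map_smul (Algebra.trace K F),
    Algebra.smul_def]
  congr 1
  ring

theorem isLCD_of_eq_range_traceWord {K F : Type*} [Field K] [Fintype K] [Field F] [Finite F]
    [Algebra K F] {n : ℕ} (hn : n ≠ 0) {α β : F} (hα : IsPrimitiveRoot α n) {Z : Set (ZMod n)}
    {g : K[X]} (hg : g ∣ X ^ n - 1) (hgZ : g.map (algebraMap K F) = zeroPolynomial n α Z)
    (hZ : ∀ k : ℕ, (k : ZMod n) ∉ Z ↔
      ∃ j, α ^ k = β ^ Fintype.card K ^ j ∨ α ^ k = β⁻¹ ^ Fintype.card K ^ j)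
    (hrange : cyclicCode n g = LinearMap.range (traceWord K n β)) : IsLCD (cyclicCode n g) := by
  refine (Submodule.eq_bot_iff _).2 fun c ⟨hc, hc'⟩ ↦ ?_
  have hdual (a b : F) : ∑ i, c i * traceWord K n β (a, b) i = 0 :=
    hc' _ (hrange ▸ ⟨(a, b), rfl⟩)
  refine eq_zero_of_mem_cyclicCode hn hα hg hgZ hZ hc ?_ ?_
  · exact aeval_eq_zero_of_forall_sum_mul_traceWord_eq_zero fun a ↦ hdual a 0
  · refine aeval_eq_zero_of_forall_sum_mul_traceWord_eq_zero fun a ↦ ?_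
    rw [← traceWord_swap]
    exact hdual 0 a

/-! ### Specialization to `n = 3 ^ m - 1` -/

/-- Take `θ = α ^ (d / 2)`. A prime dividing both `d / 2` and `n = 5d + 2 * 3 ^ (4l + 2)` is 2 or 3,
but `d / 2` is odd and `n` is prime to 3. -/
theorem exists_isPrimitiveRoot_sq_eq {F : Type*} [Field F] {l n d : ℕ} {α : F}
    (hα : IsPrimitiveRoot α n) (hn : n + 1 = 3 ^ (4 * l + 6))
    (hd : 5 * d + 1 = 711 * 3 ^ (4 * l)) : ∃ θ : F, IsPrimitiveRoot θ n ∧ θ ^ 2 = α ^ d := by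
  have h8 : 3 ^ (4 * l) % 8 = 1 := by
    rw [show 4 * l = 2 * (2 * l) by ring, pow_mul, Nat.pow_mod]
    simp
  have h2 : 5 * d + 2 * 3 ^ (4 * l + 2) = n := by
    rw [pow_add] at hn ⊢
    omega
  obtain ⟨u, rfl⟩ : ∃ u, d = 2 * u := ⟨d / 2, by omega⟩
  refine ⟨α ^ u, hα.pow_of_coprime u ?_, by rw [← pow_mul, mul_comm]⟩
  refine Nat.Coprime.symm (Nat.coprime_of_dvd fun p hp hpn hpu ↦ ?_)
  have hp' : p ∣ 2 * 3 ^ (4 * l + 2) := by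
    rw [← h2] at hpn
    exact (Nat.dvd_add_right ((hpu.mul_left 2).mul_left 5)).1 hpn
  rw [pow_add] at hn
  rcases hp.dvd_mul.1 hp' with h | h
  · obtain rfl := (Nat.prime_dvd_prime_iff_eq hp Nat.prime_two).1 h
    omega
  · obtain rfl := (Nat.prime_dvd_prime_iff_eq hp Nat.prime_three).1 (hp.dvd_of_dvd_pow h)
    omega

theorem cast_eq_mul_iff_pow_eq {F : Type*} [Field F] {n : ℕ} {α : F} (hα : IsPrimitiveRoot α n)
    (hn : n ≠ 0) (k d e : ℕ) : (k : ZMod n) = d * (e : ZMod n) ↔ α ^ k = (α ^ d) ^ e := by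
  rw [← pow_mul, ← Nat.cast_mul]
  exact ⟨pow_eq_pow_of_cast_eq hα.pow_eq_one, cast_eq_cast_of_pow_eq_pow hα hn⟩

theorem cast_eq_neg_mul_iff_pow_eq {F : Type*} [Field F] {n : ℕ} {α : F} (hα : IsPrimitiveRoot α n)
    (hn : n ≠ 0) (k d e : ℕ) :
    (k : ZMod n) = -(d * (e : ZMod n)) ↔ α ^ k = (α ^ d)⁻¹ ^ e := by
  have h0 : α ^ (d * e) ≠ 0 := pow_ne_zero _ (hα.ne_zero hn)
  rw [inv_pow, ← pow_mul, ← mul_eq_one_iff_eq_inv₀ h0, ← pow_add, eq_neg_iff_add_eq_zero,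
    ← Nat.cast_mul, ← Nat.cast_add, ← pow_zero α, ← Nat.cast_zero (R := ZMod n)]
  exact ⟨pow_eq_pow_of_cast_eq hα.pow_eq_one, cast_eq_cast_of_pow_eq_pow hα hn⟩

theorem five_mul_add_one_of_eq {l d : ℕ} (hd : d = (3 ^ (4 * l) - 1) / 5 + 3 ^ (4 * l) +
    2 * 3 ^ (4 * l + 1) + 2 * 3 ^ (4 * l + 3) + 3 ^ (4 * l + 4)) :
    5 * d + 1 = 711 * 3 ^ (4 * l) := by
  have h5 : 3 ^ (4 * l) % 5 = 1 := by
    rw [pow_mul, Nat.pow_mod]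
    simp
  simp only [pow_add _ (4 * l)] at hd
  omega

theorem three_pow_sub_one_mod_eight {n l : ℕ} (hn : n + 1 = 3 ^ (4 * l + 6)) : n % 8 = 0 := by
  have h8 : 3 ^ (4 * l + 6) % 8 = 1 := by
    rw [show 4 * l + 6 = 2 * (2 * l + 3) by ring, pow_mul, Nat.pow_mod]
    simp
  omega

theorem hasParametersGE_of_forall_hammingNorm {K : Type*} [Field K] [DecidableEq K] {n : ℕ}
    {D : Submodule K (Fin n → K)} {k d : ℕ} (hk : Module.finrank K D = k)
    (hd : ∀ c ∈ D, c ≠ 0 → d ≤ hammingNorm c) : HasParametersGE D k d := by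
  refine ⟨hk, fun x hx y hy hxy ↦ ?_⟩
  rw [hammingDist_eq_hammingNorm]
  exact hd _ (D.add_mem (D.neg_mem hx) hy) fun h ↦ hxy (neg_add_eq_zero.1 h)

theorem theorem4p8 (m : ℕ) (hm : m % 4 = 2) (hm6 : 6 ≤ m)
    (F : Type*) [Field F] [Fintype F] [Algebra (ZMod 3) F] (hF : Fintype.card F = 3 ^ m)
    (n δ₁ δ₂ δ₃ : ℕ) (hn : n = 3 ^ m - 1)
    (hδ₁ : δ₁ = (3 ^ m - 1) / 2) (hδ₂ : δ₂ = (3 ^ m - 1) / 4)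
    (hδ₃ : δ₃ = (3 ^ (m - 6) - 1) / 5 + 3 ^ (m - 6) + 2 * 3 ^ (m - 5) + 2 * 3 ^ (m - 3)
      + 3 ^ (m - 2))
    (α : F) (hα : IsPrimitiveRoot α n)
    (Z : Set (ZMod n))
    (hZ : Z = {i | ∃ s : ℤ, |s| < (δ₃ : ℤ) ∧ i ∈ cyclotomicCoset 3 n (s : ZMod n)}
      ∪ cyclotomicCoset 3 n (δ₁ : ZMod n) ∪ cyclotomicCoset 3 n (δ₂ : ZMod n)) :
    -- the product over `Z` has its coefficients in the prime field, and divides `x ^ n - 1` there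
    ∃ g : (ZMod 3)[X], g.map (algebraMap (ZMod 3) F) = zeroPolynomial n α Z ∧ g ∣ X ^ n - 1 ∧
      -- BCH structure: designed distance `2 δ₃`, attained at the offset `-δ₃`
      bchDefiningSet 3 n (2 * δ₃) (-(δ₃ : ℤ)) ⊆ Z ∧
      IsGreatest {d : ℕ | ∃ b : ℤ, bchDefiningSet 3 n d b ⊆ Z} (2 * δ₃) ∧
      IsLCD (cyclicCode n g) ∧
      -- the trace description, with the nonzero elements of `F` listed as `x = θ ^ i`
      (∃ θ : F, IsPrimitiveRoot θ n ∧ θ ^ 2 = α ^ δ₃ ∧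
        ∀ c : Fin n → ZMod 3, c ∈ cyclicCode n g ↔
          ∃ a b : F, ∀ i : Fin n,
            c i = Algebra.trace (ZMod 3) F
              (a * (θ ^ (i : ℕ)) ^ 2 + b * (θ ^ (i : ℕ)) ^ (-2 : ℤ))) ∧
      HasParametersGE (cyclicCode n g) (2 * m) (2 * δ₃) := by
  obtain ⟨l, rfl⟩ : ∃ l, m = 4 * l + 6 := ⟨(m - 6) / 4, by omega⟩
  have hpos : 0 < 3 ^ (4 * l + 6) := by positivity
  rw [← hn] at hδ₁ hδ₂
  replace hn : n + 1 = 3 ^ (4 * l + 6) := by omega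
  replace hδ₃ : 5 * δ₃ + 1 = 711 * 3 ^ (4 * l) := five_mul_add_one_of_eq hδ₃
  have hn8 := three_pow_sub_one_mod_eight hn
  have hd₁ : 2 * δ₁ = n := by omega
  have hd₂ : 4 * δ₂ = n := by omega
  have hn1 : 1 < 3 ^ (4 * l + 6) := Nat.one_lt_pow (by omega) (by norm_num)
  have hn0 : n ≠ 0 := by omega
  have hδ0 : 0 < δ₃ := by
    have : 0 < 3 ^ (4 * l) := by positivity
    omega
  have hδn : 2 * δ₃ ≤ n := by
    rw [pow_add] at hn
    omega
  replace hZ : Z = symmetricDefiningSet n δ₁ δ₂ δ₃ := hZ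
  have hmem {i : ZMod n} := notMem_symmetricDefiningSet_iff hn hδ₃ hd₁ hd₂ (i := i)
  rw [← hZ] at hmem
  have hchar : CharP F 3 := charP_of_injective_algebraMap (algebraMap (ZMod 3) F).injective 3
  have hnF : (n : F) ≠ 0 := by
    have h := congrArg (Nat.cast : ℕ → F) hn
    have h3 : (3 : F) = 0 := by exact_mod_cast CharP.cast_eq_zero F 3
    push_cast at h
    rw [h3, zero_pow (by omega)] at h
    rw [eq_neg_of_add_eq_zero_left h]
    exact neg_ne_zero.2 one_ne_zero
  have hrank : Module.finrank (ZMod 3) F = 4 * l + 6 := by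
    have h := Module.card_eq_pow_finrank (K := ZMod 3) (V := F)
    rw [hF, ZMod.card] at h
    exact (Nat.pow_right_injective (by norm_num : 2 ≤ 3) h).symm
  set β := α ^ δ₃ with hβ
  have hβn : β ^ n = 1 := by rw [hβ, pow_right_comm, hα.pow_eq_one, one_pow]
  have hβ0 : β ≠ 0 := pow_ne_zero _ (hα.ne_zero hn0)
  have h1 : ∀ k < Module.finrank (ZMod 3) F, β ^ Fintype.card (ZMod 3) ^ k = β → k = 0 := by
    intro k hk h
    rw [hrank] at hk
    by_contra hk0
    refine cast_mul_three_pow_ne_self hn hδ₃ hk hk0 ?_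
    simpa using ((cast_eq_mul_iff_pow_eq hα hn0 δ₃ δ₃ (3 ^ k)).2
      (by simpa [ZMod.card] using h.symm)).symm
  have h2 : ∀ k, β ^ Fintype.card (ZMod 3) ^ k ≠ β⁻¹ := by
    intro k h
    refine cast_mul_three_pow_ne_neg hn hδ₃ k ?_
    have := (cast_eq_neg_mul_iff_pow_eq hα hn0 (δ₃ * 3 ^ k) δ₃ 1).2
      (by rw [pow_one, pow_mul]; simpa [ZMod.card] using h)
    simpa using this
  have hnon : ∀ k : ℕ, (k : ZMod n) ∉ Z ↔ ∃ j, α ^ k = β ^ Fintype.card (ZMod 3) ^ j ∨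
      α ^ k = β⁻¹ ^ Fintype.card (ZMod 3) ^ j := by
    intro k
    rw [hmem]
    refine exists_congr fun j ↦ ?_
    rw [ZMod.card, ← cast_eq_mul_iff_pow_eq hα hn0, ← cast_eq_neg_mul_iff_pow_eq hα hn0]
    push_cast
    rfl
  have hclosed : ∀ i ∈ Z, ∃ j ∈ Z, j * (3 : ℕ) = i := by
    intro i hi
    have hpow (j : ℕ) : i * 3 ^ j ∈ Z := by
      induction j with
      | zero => simpa using hi
      | succ j ih =>
        rw [hZ] at ih ⊢
        rw [pow_succ, ← mul_assoc]
        exact mul_three_mem_symmetricDefiningSet ih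
    refine ⟨_, hpow (4 * l + 5), ?_⟩
    push_cast
    rw [mul_assoc, ← pow_succ, three_pow_cast_eq_one hn, mul_one]
  obtain ⟨g, hgZ⟩ := exists_map_eq_zeroPolynomial (p := 3) hα hn0 hclosed
  have hg : g ∣ X ^ n - 1 := by
    rw [← map_dvd_map' (algebraMap (ZMod 3) F), hgZ, zeroPolynomial_dvd_iff hα hn0]
    intro k _
    simp [pow_right_comm α k n, hα.pow_eq_one]
  have hsub : bchDefiningSet 3 n (2 * δ₃) (-(δ₃ : ℤ)) ⊆ Z := hZ ▸ bchDefiningSet_neg_subset _ _ _ _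
  have hrange := cyclicCode_eq_range_traceWord hnF hα hβn hβ0 h1 h2 hg hgZ hnon
  obtain ⟨θ, hθ, hθ2⟩ := exists_isPrimitiveRoot_sq_eq hα hn hδ₃
  refine ⟨g, hgZ, hg, hsub, ⟨⟨_, hsub⟩, ?_⟩,
    isLCD_of_eq_range_traceWord hn0 hα hg hgZ hnon hrange, ⟨θ, hθ, hθ2, fun c ↦ ?_⟩,
    hasParametersGE_of_forall_hammingNorm ?_ fun c hc hc0 ↦ ?_⟩
  · rintro D ⟨b, hb⟩
    exact le_of_bchDefiningSet_subset hn hδ₃ hd₁ hd₂ (hZ ▸ hb)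
  · rw [hrange]
    have hθβ (a b : F) (i : Fin n) : Algebra.trace (ZMod 3) F
        (a * (θ ^ (i : ℕ)) ^ 2 + b * (θ ^ (i : ℕ)) ^ (-2 : ℤ)) =
        traceWord (ZMod 3) n β (a, b) i := by
      rw [traceWord_apply, hβ, ← hθ2, zpow_neg, zpow_ofNat, pow_right_comm, inv_pow]
    simp only [LinearMap.mem_range, Prod.exists, hθβ, funext_iff, eq_comm]
  · rw [hrange, LinearMap.finrank_range_of_inj (traceWord_injective hnF hβn hβ0 h1 h2),
      Module.finrank_prod, hrank]
    ring
  -- The `2 * δ₃ - 1` zeros are at the exponents from `-(δ₃ - 1)` to `δ₃ - 1`, shifted by `n` to be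
  -- natural numbers; the strict BCH inequality supplies the last unit.
  · have := lt_hammingNorm_of_aeval_eq_zero hα hc0 (b := n - (δ₃ - 1)) (D := 2 * δ₃ - 1)
      fun k hk ↦ (mem_cyclicCode_iff hα hn0 hg hgZ).1 hc _ (hsub ⟨k + 1, by omega, by omega, ?_⟩)
    · omega
    · have hk' : ((n - (δ₃ - 1) + k : ℕ) : ZMod n) = ((-(δ₃ : ℤ) + (k + 1 : ℕ) : ℤ) : ZMod n) := by
        rw [← Int.cast_natCast (R := ZMod n), ZMod.intCast_eq_intCast_iff_dvd_sub]
        exact ⟨-1, by omega⟩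
      rw [hk']
      exact mem_cyclotomicCoset_self _ _ _
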